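/- Let $M$ be a smooth manifold, $\pi:TM\setminus 0\to M$ its tangent bundle without the null section, $\mathcal V TM=\ker d\pi\subset T(TM\setminus 0)$ the vertical bundle, $i_w:T_{\pi(w)}M\to\mathcal V_wTM$, $i_w(u)=\frac{d}{dt}\big|_{t=0}(w+tu)$, the vertical lift at $w$, $C(w)=i_w(w)$, and $\mathcal J(\xi)=i_w(d\pi(\xi))$ for $\xi\in T_w(TM\setminus 0)$. For a vector field $V$ defined along a map $f$ into $M$, let $V^{\mathfrak v}$ denote its vertical lift along a lift of $f$ to $TM\setminus 0$, obtained by applying $i_w$ pointwise. Let $S$ be a spray on $M$, i.e. a smooth vector field on $TM\setminus0$ with $\mathcal J(S)=C$ and $[C,S]=S$, and let $\Gamma_S=-[S,\mathcal J]$ be its canonical connection, with horizontal distribution $\mathcal H TM=\ker(\Gamma_S-\mathbf I)$. A linear connection $\nabla$ on $\mathcal V TM\to TM\setminus0$ is a *lift* of $\Gamma_S$ if $\nabla_XC=X$ for all vertical $X$ and $\nabla_XC=0$ exactly when $X$ is horizontal. Its torsion is $\mathrm T(X,Y)=\nabla_X\mathcal J(Y)-\nabla_Y\mathcal J(X)-\mathcal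 J[X,Y]$. Consider the conditions * **(T1)** $\mathrm T(S,Y)=0$ for all $Y$; * **(T3)** $\mathrm T(X,Y)=0$ for all $X,Y$. For a lift $\nabla$, $w\in TM\setminus 0$, $u\in T_{\pi(w)}M$ and a smooth vector field $V$ near $\pi(w)$, put $D^w_uV=i_w^{-1}\nabla_{u^{\mathfrak h}}V^{\mathfrak v}$, where $u^{\mathfrak h}$ is the horizontal lift of $u$ at $w$. If $\lambda:I\to M$ is a smooth curve with $\lambda(t_0)=\pi(w)$ and $V$ is a smooth vector field along $\lambda$, let $\frac{D^wV}{dt}\in T_{\pi(w)}M$ be the covariant derivative at $t_0$ induced by $D^w$; equivalently, $$\frac{D^wV}{dt}=i_w^{-1}\Big(\frac{\nabla V^{\mathfrak v}}{dt}\Big)(t_0),\qquad(\ast)$$ where $V^{\mathfrak v}$ is the vertical lift of $V$ along the horizontal lift of $\lambda$ through $w$ at $t=t_0$. For a nowhere null vector field $W$ on an open set $\mathcal O\subseteq M$ (resp. along $\lambda$), $D^W$ is obtained by taking $w=W(x)$ at each $x\in\mathcal O$ (resp. $w=W(t)$ at each $t\in I$). 1. If $\nabla,\nabla'$ are two lifts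 of $\Gamma_S$ satisfying (T1), then for every nowhere null smooth vector field $W$ on an open set $\mathcal O\subseteq M$ the operators $V\mapsto D^W_WV$ on smooth vector fields on $\mathcal O$ defined by $\nabla$ and by $\nabla'$ coincide; and for every regular smooth curve $\lambda:I\to M$ the operators $V\mapsto\frac{D^{\dot\lambda}V}{dt}$ on smooth vector fields along $\lambda$ defined by $\nabla$ and by $\nabla'$ coincide. That is, these operators depend only on the spray $S$. 2. If $\nabla$ is a lift of $\Gamma_S$ satisfying (T3), then $D^w_uV=i_w^{-1}\nabla_\xi V^{\mathfrak v}$ for every $\xi\in T_w(TM\setminus0)$ with $d\pi(\xi)=u$; and for every smooth curve $\lambda:I\to M$, formula $(\ast)$ holds along every smooth lift $\overline\lambda:I\to TM\setminus 0$ of $\lambda$ with $\overline\lambda(t_0)=w$, horizontal or not. -/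

import Mathlib

open Set Filter Topology Bundle
open scoped Manifold ContDiff

noncomputable section

namespace SprayGeometry

variable {E : Type*} [NormedAddCommGroup E] [NormedSpace ℝ E]
  {M : Type*} [TopologicalSpace M] [ChartedSpace E M] [IsManifold 𝓘(ℝ, E) ∞ M]

/-! ### Fields on the slit tangent bundle

Vector fields on `TM ∖ 0` are represented by fields on the total space `TM`; only their values on
the open set `slit` are ever used. -/

/-- The slit tangent bundle `TM ∖ 0`, as an open subset of `TM`. -/
def slit (E : Type*) [NormedAddCommGroup E] [NormedSpace ℝ E]
    (M : Type*) [TopologicalSpace M] [ChartedSpace E M] [IsManifold 𝓘(ℝ, E) ∞ M] :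
    Set (TangentBundle 𝓘(ℝ, E) M) :=
  {w | w.2 ≠ 0}

/-- (Not necessarily continuous) sections of `T(TM)`. -/
abbrev Field (E : Type*) [NormedAddCommGroup E] [NormedSpace ℝ E]
    (M : Type*) [TopologicalSpace M] [ChartedSpace E M] [IsManifold 𝓘(ℝ, E) ∞ M] : Type _ :=
  (w : TangentBundle 𝓘(ℝ, E) M) → TangentSpace 𝓘(ℝ, E).tangent w

/-- The vector field `X` is smooth on the set `U ⊆ TM`. -/
def SmoothOn (X : Field E M) (U : Set (TangentBundle 𝓘(ℝ, E) M)) : Prop :=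
  ContMDiffOn 𝓘(ℝ, E).tangent 𝓘(ℝ, E).tangent.tangent ∞
    (fun w => (⟨w, X w⟩ : TangentBundle 𝓘(ℝ, E).tangent (TangentBundle 𝓘(ℝ, E) M))) U

/-- The vector field `V` on `M` is smooth on the set `O ⊆ M`. -/
def SmoothOnBase (V : (x : M) → TangentSpace 𝓘(ℝ, E) x) (O : Set M) : Prop :=
  ContMDiffOn 𝓘(ℝ, E) 𝓘(ℝ, E).tangent ∞ (fun x => (⟨x, V x⟩ : TangentBundle 𝓘(ℝ, E) M)) O

/-- The differential `dπ(w) : T_w(TM) → T_{π(w)}M` of the projection. -/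
def dproj (w : TangentBundle 𝓘(ℝ, E) M) :
    TangentSpace 𝓘(ℝ, E).tangent w →L[ℝ] TangentSpace 𝓘(ℝ, E) w.1 :=
  mfderiv 𝓘(ℝ, E).tangent 𝓘(ℝ, E) (fun p : TangentBundle 𝓘(ℝ, E) M => p.1) w

/-- `ξ ∈ T_w(TM)` is vertical if it lies in the kernel of `dπ(w)`. -/
def IsVertical {w : TangentBundle 𝓘(ℝ, E) M} (ξ : TangentSpace 𝓘(ℝ, E).tangent w) : Prop :=
  dproj w ξ = 0

/-- `Y` is a smooth section of the vertical tangent bundle over the set `U`. -/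
def IsVerticalSectionOn (Y : Field E M) (U : Set (TangentBundle 𝓘(ℝ, E) M)) : Prop :=
  SmoothOn Y U ∧ ∀ w ∈ U, IsVertical (Y w)

/-- The vertical lift `i_w(u) = d/dt|_{t=0} (w + t u)`. -/
def vlift (w : TangentBundle 𝓘(ℝ, E) M) (u : TangentSpace 𝓘(ℝ, E) w.1) :
    TangentSpace 𝓘(ℝ, E).tangent w :=
  mfderiv 𝓘(ℝ, ℝ) 𝓘(ℝ, E).tangent
    (fun t : ℝ => (⟨w.1, w.2 + t • u⟩ : TangentBundle 𝓘(ℝ, E) M)) 0 (1 : ℝ)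

/-- The inverse of `i_w : T_{π(w)}M → V_wTM` (with a junk value off the vertical subspace). -/
def vliftInv (w : TangentBundle 𝓘(ℝ, E) M) (ξ : TangentSpace 𝓘(ℝ, E).tangent w) :
    TangentSpace 𝓘(ℝ, E) w.1 :=
  Function.invFun (vlift w) ξ

/-- The vertical lift `V^v` of a vector field `V` on `M`. -/
def vliftField (V : (x : M) → TangentSpace 𝓘(ℝ, E) x) : Field E M :=
  fun w => vlift w (V w.1)

/-- The canonical vector field `C(w) = i_w(w)`. -/
def canonicalField (E : Type*) [NormedAddCommGroup E] [NormedSpace ℝ E]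
    (M : Type*) [TopologicalSpace M] [ChartedSpace E M] [IsManifold 𝓘(ℝ, E) ∞ M] : Field E M :=
  fun w => vlift w w.2

/-- The almost-tangent structure `J(ξ) = i_w(dπ(ξ))`. -/
def almostTangent (w : TangentBundle 𝓘(ℝ, E) M) (ξ : TangentSpace 𝓘(ℝ, E).tangent w) :
    TangentSpace 𝓘(ℝ, E).tangent w :=
  vlift w (dproj w ξ)

/-- The field `J(X)`. -/
def almostTangentField (X : Field E M) : Field E M :=
  fun w => almostTangent w (X w)

/-- The Lie bracket of vector fields on `TM`. -/
def bracket (X Y : Field E M) : Field E M :=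
  VectorField.mlieBracket 𝓘(ℝ, E).tangent X Y

/-! ### Sprays and their canonical connections -/

/-- `S` is a spray: a smooth vector field on `TM ∖ 0` with `J(S) = C` and `[C, S] = S`. -/
structure IsSpray (S : Field E M) : Prop where
  smooth : SmoothOn S (slit E M)
  second_order : ∀ w ∈ slit E M, almostTangent w (S w) = canonicalField E M w
  homogeneous : ∀ w ∈ slit E M, bracket (canonicalField E M) S w = S w

/-- The canonical connection `Γ_S = -[S, J]`, i.e. `Γ_S(X) = J [S, X] - [S, J X]`, evaluated at
`ξ ∈ T_w(TM)`. As `Γ_S` is a tensor field, the value at `w` may be computed with any local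
field `X` with `X(w) = ξ`; we use the one which is constant in the standard trivialization. -/
def canonicalConnection (S : Field E M) (w : TangentBundle 𝓘(ℝ, E) M)
    (ξ : TangentSpace 𝓘(ℝ, E).tangent w) : TangentSpace 𝓘(ℝ, E).tangent w :=
  let X : Field E M := FiberBundle.extend (E × E) ξ
  almostTangent w (bracket S X w) - bracket S (almostTangentField X) w

/-- `ξ ∈ T_w(TM)` is horizontal: `ξ ∈ ker(Γ_S - I)`. -/
def IsHorizontal (S : Field E M) {w : TangentBundle 𝓘(ℝ, E) M}
    (ξ : TangentSpace 𝓘(ℝ, E).tangent w) : Prop :=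
  canonicalConnection S w ξ = ξ

/-- The horizontal lift of `u ∈ T_xM` at `w ∈ T_xM`: the unique horizontal vector
`ξ ∈ T_w(TM)` with `dπ(ξ) = u`. -/
def horizontalLift (S : Field E M) (w : TangentBundle 𝓘(ℝ, E) M)
    (u : TangentSpace 𝓘(ℝ, E) w.1) : TangentSpace 𝓘(ℝ, E).tangent w :=
  Classical.epsilon fun ξ => IsHorizontal S ξ ∧ dproj w ξ = u

/-! ### Linear connections on the vertical tangent bundle -/

/-- A (smooth) linear connection `∇` on the vertical tangent bundle `VTM → TM ∖ 0`:
`cov Y w ξ` is `∇_ξ Y` for `ξ ∈ T_w(TM)`, `w ∈ TM ∖ 0`, and `Y` a smooth section of `VTM` defined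
on a neighbourhood of `w`. The values of `cov` on other arguments are irrelevant. -/
structure VerticalConnection (E : Type*) [NormedAddCommGroup E] [NormedSpace ℝ E]
    (M : Type*) [TopologicalSpace M] [ChartedSpace E M] [IsManifold 𝓘(ℝ, E) ∞ M] where
  cov : Field E M → (w : TangentBundle 𝓘(ℝ, E) M) →
    TangentSpace 𝓘(ℝ, E).tangent w →L[ℝ] TangentSpace 𝓘(ℝ, E).tangent w
  vertical : ∀ U ⊆ slit E M, IsOpen U → ∀ Y, IsVerticalSectionOn Y U →
    ∀ w ∈ U, ∀ ξ, IsVertical (cov Y w ξ)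
  add : ∀ U ⊆ slit E M, IsOpen U → ∀ Y Z, IsVerticalSectionOn Y U → IsVerticalSectionOn Z U →
    ∀ w ∈ U, ∀ ξ, cov (Y + Z) w ξ = cov Y w ξ + cov Z w ξ
  leibniz : ∀ U ⊆ slit E M, IsOpen U → ∀ Y, IsVerticalSectionOn Y U →
    ∀ f : TangentBundle 𝓘(ℝ, E) M → ℝ, ContMDiffOn 𝓘(ℝ, E).tangent 𝓘(ℝ, ℝ) ∞ f U →
    ∀ w ∈ U, ∀ ξ, cov (fun p => f p • Y p) w ξ =
      mvfderiv 𝓘(ℝ, E).tangent f w ξ • Y w + f w • cov Y w ξ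
  smooth : ∀ U ⊆ slit E M, IsOpen U → ∀ X Y, SmoothOn X U → IsVerticalSectionOn Y U →
    SmoothOn (fun w => cov Y w (X w)) U

/-- `∇` is almost-projectable: `∇_X C = X` for all vertical `X`. -/
def VerticalConnection.AlmostProjectable (D : VerticalConnection E M) : Prop :=
  ∀ w ∈ slit E M, ∀ ξ : TangentSpace 𝓘(ℝ, E).tangent w,
    IsVertical ξ → D.cov (canonicalField E M) w ξ = ξ

/-- `∇` is a lift of `Γ_S`: it is almost-projectable, and the kernel of `X ↦ ∇_X C` is the
horizontal distribution of `Γ_S`. -/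
def VerticalConnection.IsLift (D : VerticalConnection E M) (S : Field E M) : Prop :=
  D.AlmostProjectable ∧ ∀ w ∈ slit E M, ∀ ξ : TangentSpace 𝓘(ℝ, E).tangent w,
    D.cov (canonicalField E M) w ξ = 0 ↔ IsHorizontal S ξ

/-- The torsion `T(X, Y) = ∇_X J(Y) - ∇_Y J(X) - J[X, Y]`. -/
def VerticalConnection.torsion (D : VerticalConnection E M) (X Y : Field E M) : Field E M :=
  fun w => D.cov (almostTangentField Y) w (X w) - D.cov (almostTangentField X) w (Y w)
    - almostTangent w (bracket X Y w)

/-- Condition (T1): the torsion tensor satisfies `T(S, Y) = 0` for all (local) fields `Y`. -/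
def VerticalConnection.T1 (D : VerticalConnection E M) (S : Field E M) : Prop :=
  ∀ U ⊆ slit E M, IsOpen U → ∀ Y, SmoothOn Y U → ∀ w ∈ U, D.torsion S Y w = 0

/-- Condition (T3): the torsion tensor satisfies `T(X, Y) = 0` for all (local) fields `X, Y`. -/
def VerticalConnection.T3 (D : VerticalConnection E M) : Prop :=
  ∀ U ⊆ slit E M, IsOpen U → ∀ X Y, SmoothOn X U → SmoothOn Y U → ∀ w ∈ U, D.torsion X Y w = 0

/-! ### The associated family of affine connections -/

/-- `i_w⁻¹ ∇_ξ V^v` for `ξ ∈ T_w(TM)` and a vector field `V` on `M`. -/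
def VerticalConnection.affineAlong (D : VerticalConnection E M) (w : TangentBundle 𝓘(ℝ, E) M)
    (ξ : TangentSpace 𝓘(ℝ, E).tangent w) (V : (x : M) → TangentSpace 𝓘(ℝ, E) x) :
    TangentSpace 𝓘(ℝ, E) w.1 :=
  vliftInv w (D.cov (vliftField V) w ξ)

/-- `D^w_u V = i_w⁻¹ ∇_{u^h} V^v`, with `u^h` the horizontal lift of `u` at `w`. -/
def VerticalConnection.affine (D : VerticalConnection E M) (S : Field E M)
    (w : TangentBundle 𝓘(ℝ, E) M) (u : TangentSpace 𝓘(ℝ, E) w.1)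
    (V : (x : M) → TangentSpace 𝓘(ℝ, E) x) : TangentSpace 𝓘(ℝ, E) w.1 :=
  D.affineAlong w (horizontalLift S w u) V

/-- The affine connection `D^W_U V` on the domain of the nowhere null field `W`. -/
def VerticalConnection.affineField (D : VerticalConnection E M) (S : Field E M)
    (W U V : (x : M) → TangentSpace 𝓘(ℝ, E) x) : (x : M) → TangentSpace 𝓘(ℝ, E) x :=
  fun x => D.affine S ⟨x, W x⟩ (U x) V

/-! ### Covariant derivatives along curves

Curves are maps `c : ℝ → M` restricted to an interval `I`, and a field along `c` is given by
`V t ∈ T_{c(t)}M`. A lift of `c` to `TM ∖ 0` is the same thing as a nowhere null field `ℓ` along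
`c`, namely the curve `t ↦ (c(t), ℓ(t))` in `TM`. -/

/-- The field `V` along the curve `c` (equivalently, the curve `t ↦ (c(t), V(t))` in `TM`) is smooth
on `I`. -/
def SmoothAlong (c : ℝ → M) (I : Set ℝ) (V : (t : ℝ) → TangentSpace 𝓘(ℝ, E) (c t)) : Prop :=
  ContMDiffOn 𝓘(ℝ, ℝ) 𝓘(ℝ, E).tangent ∞
    (fun t => (⟨c t, V t⟩ : TangentBundle 𝓘(ℝ, E) M)) I

/-- The velocity of the curve `c : I → M` (one-sided at the end points of `I`). -/
def velocity (c : ℝ → M) (I : Set ℝ) (t : ℝ) : TangentSpace 𝓘(ℝ, E) (c t) :=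
  mfderivWithin 𝓘(ℝ, ℝ) 𝓘(ℝ, E) c I t (1 : ℝ)

/-- The velocity of the curve `t ↦ (c(t), ℓ(t))` in `TM`. -/
def liftVelocity (c : ℝ → M) (I : Set ℝ) (l : (t : ℝ) → TangentSpace 𝓘(ℝ, E) (c t)) (t : ℝ) :
    TangentSpace 𝓘(ℝ, E).tangent (⟨c t, l t⟩ : TangentBundle 𝓘(ℝ, E) M) :=
  mfderivWithin 𝓘(ℝ, ℝ) 𝓘(ℝ, E).tangent
    (fun s => (⟨c s, l s⟩ : TangentBundle 𝓘(ℝ, E) M)) I t (1 : ℝ)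

/-- The coordinate derivative at `t₀` of a field along `c`: if `(e_a)` is the coordinate frame of
the preferred chart at `c(t₀)` and `V = ∑ y^a e_a`, this is `∑ (y^a)'(t₀) e_a`. -/
def coordDeriv (c : ℝ → M) (I : Set ℝ) (V : (t : ℝ) → TangentSpace 𝓘(ℝ, E) (c t)) (t₀ : ℝ) :
    TangentSpace 𝓘(ℝ, E) (c t₀) :=
  (trivializationAt E (TangentSpace 𝓘(ℝ, E)) (c t₀)).symm (c t₀)
    (derivWithin (fun t => (trivializationAt E (TangentSpace 𝓘(ℝ, E)) (c t₀)
      (⟨c t, V t⟩ : TangentBundle 𝓘(ℝ, E) M)).2) I t₀)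

/-- The local field `∑ y^a(t₀) e_a` on `M` with constant coefficients in the coordinate frame `(e_a)`
at `c(t₀)`, whose value at `c(t₀)` is `V(t₀) = ∑ y^a(t₀) e_a`. -/
def frozen (c : ℝ → M) (V : (t : ℝ) → TangentSpace 𝓘(ℝ, E) (c t)) (t₀ : ℝ) :
    (x : M) → TangentSpace 𝓘(ℝ, E) x :=
  FiberBundle.extend E (V t₀)

/-- `D^wV/dt ∈ T_xM` for a field `V` along `c`, where `c(t₀) = x` and `w ∈ T_xM`: the covariant
derivative along `c` induced by `D^w`, that is, for `V = ∑ y^a e_a`,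
`∑ (y^a)'(t₀) e_a + ∑ y^a(t₀) D^w_{c'(t₀)} e_a`. -/
def VerticalConnection.covDeriv (D : VerticalConnection E M) (S : Field E M)
    (c : ℝ → M) (I : Set ℝ) (t₀ : ℝ) (w : TangentSpace 𝓘(ℝ, E) (c t₀))
    (V : (t : ℝ) → TangentSpace 𝓘(ℝ, E) (c t)) : TangentSpace 𝓘(ℝ, E) (c t₀) :=
  coordDeriv c I V t₀ +
    D.affine S (⟨c t₀, w⟩ : TangentBundle 𝓘(ℝ, E) M) (velocity c I t₀) (frozen c V t₀)

/-- `(∇V^v/dt)(t₀)` for the vertical lift `V^v(t) = i_{ℓ(t)}(V(t))` of `V` along the lift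
`t ↦ (c(t), ℓ(t))` of `c`: the covariant derivative along the lifted curve induced by `∇`,
that is, for `V^v = ∑ y^a (e_a)^v`, the vector
`∑ (y^a)'(t₀) (e_a)^v + ∑ y^a(t₀) ∇_{ℓ'(t₀)} (e_a)^v`. -/
def VerticalConnection.covDerivLift (D : VerticalConnection E M)
    (c : ℝ → M) (I : Set ℝ) (l V : (t : ℝ) → TangentSpace 𝓘(ℝ, E) (c t)) (t₀ : ℝ) :
    TangentSpace 𝓘(ℝ, E).tangent (⟨c t₀, l t₀⟩ : TangentBundle 𝓘(ℝ, E) M) :=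
  vlift (⟨c t₀, l t₀⟩ : TangentBundle 𝓘(ℝ, E) M) (coordDeriv c I V t₀) +
    D.cov (vliftField (frozen c V t₀)) (⟨c t₀, l t₀⟩ : TangentBundle 𝓘(ℝ, E) M)
      (liftVelocity c I l t₀)

/-! ### Consistency of the definitions -/

theorem triv_self (x : M) (u : TangentSpace 𝓘(ℝ, E) x) :
   (trivializationAt E (TangentSpace 𝓘(ℝ, E)) x (⟨x,u⟩ : TangentBundle 𝓘(ℝ, E) M)).2 = u := by
  exact (tangentBundleCore 𝓘(ℝ, E) M).coordChange_self _ x (mem_achart_source E x) u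

/-- In the preferred chart at `w`, `dπ(w)` is the first projection. -/
theorem dproj_eq (w : TangentBundle 𝓘(ℝ, E) M) (ξ : TangentSpace 𝓘(ℝ, E).tangent w) :
    dproj w ξ = (show E × E from ξ).1 := by
  have h : HasMFDerivAt 𝓘(ℝ, E).tangent 𝓘(ℝ, E) (fun p : TangentBundle 𝓘(ℝ, E) M => p.1) w
      (ContinuousLinearMap.fst ℝ E E) := by
    refine ⟨(FiberBundle.continuous_proj E (TangentSpace 𝓘(ℝ,E))).continuousAt, ?_⟩
    have : HasFDerivWithinAt (fun p : E × E => p.1) (ContinuousLinearMap.fst ℝ E E) (range 𝓘(ℝ, E).tangent) (extChartAt 𝓘(ℝ, E).tangent w w) := 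
      (ContinuousLinearMap.fst ℝ E E).hasFDerivAt.hasFDerivWithinAt
    have key : ∀ z ∈ (extChartAt 𝓘(ℝ, E).tangent w).target, writtenInExtChartAt 𝓘(ℝ, E).tangent 𝓘(ℝ, E) w (fun p : TangentBundle 𝓘(ℝ, E) M => p.1) z = z.1 := by
      intro z hz
      have h2 := (extChartAt 𝓘(ℝ, E).tangent w).right_inv hz
      have h3 : ((extChartAt 𝓘(ℝ, E).tangent w) ((extChartAt 𝓘(ℝ, E).tangent w).symm z)).1 = z.1 := by rw [h2]
      exact h3
    refine this.congr_of_eventuallyEq ?_ ?_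
    · have h1 : ∀ᶠ z in 𝓝[range 𝓘(ℝ, E).tangent] (extChartAt 𝓘(ℝ, E).tangent w w), z ∈ (extChartAt 𝓘(ℝ, E).tangent w).target := extChartAt_target_mem_nhdsWithin w
      filter_upwards [h1] with z hz using key z hz
    · exact key _ (mem_extChartAt_target w)
  rw [dproj, h.mfderiv]
  rfl

/-- In the preferred chart at `w`, `i_w(u) = (0, u)`. -/
theorem vlift_eq (w : TangentBundle 𝓘(ℝ, E) M) (u : TangentSpace 𝓘(ℝ, E) w.1) :
    vlift w u = ((0 : E), (u : E)) := by
  obtain ⟨x, v⟩ := w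
  have key : ∀ v u : E, HasMFDerivAt 𝓘(ℝ, ℝ) 𝓘(ℝ, E).tangent
    (fun t : ℝ => (⟨x, (v + t • u : E)⟩ : TangentBundle 𝓘(ℝ, E) M)) 0
      ((ContinuousLinearMap.id ℝ ℝ).smulRight (((0 : E), u))) := by
    intro v u
    have hd : HasFDerivAt (fun t : ℝ => v + t • u) ((ContinuousLinearMap.id ℝ ℝ).smulRight u) 0 :=
      (((hasFDerivAt_id (0:ℝ)).smul_const u).const_add v)
    refine ⟨?_, ?_⟩
    · rw [FiberBundle.continuousAt_totalSpace]
      refine ⟨continuousAt_const, ?_⟩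
      have : (fun t : ℝ => (trivializationAt E (TangentSpace 𝓘(ℝ, E)) x (⟨x, (v + t • u : E)⟩ : TangentBundle 𝓘(ℝ, E) M)).2) = fun t => v + t • u := by
        ext t; exact triv_self x _
      exact this ▸ hd.continuousAt
    · have h1 : HasFDerivWithinAt (fun t : ℝ => ((extChartAt 𝓘(ℝ, E) x x, v + t • u) : E × E)) ((ContinuousLinearMap.id ℝ ℝ).smulRight (((0 : E), u))) (range 𝓘(ℝ,ℝ)) 0 := by
        have := ((hasFDerivAt_const (extChartAt 𝓘(ℝ, E) x x) (0:ℝ)).prodMk hd).hasFDerivWithinAt (s := range 𝓘(ℝ,ℝ))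
        convert! this using 1
        ext <;> simp
      have h2 : ∀ t, writtenInExtChartAt 𝓘(ℝ, ℝ) 𝓘(ℝ, E).tangent (0:ℝ)
          (fun t : ℝ => (⟨x, (v + t • u : E)⟩ : TangentBundle 𝓘(ℝ, E) M)) t =
          ((extChartAt 𝓘(ℝ, E) x x, v + t • u) : E × E) := by
        intro t
        refine Prod.ext rfl ?_
        exact triv_self x _
      exact h1.congr (fun t _ => h2 t) (h2 _)
  have h := DFunLike.congr_fun (key v u).mfderiv (1:ℝ)
  exact h.trans (one_smul ℝ ((0:E),(u:E)))

theorem vlift_inj (w : TangentBundle 𝓘(ℝ, E) M) : Function.Injective (vlift w) := by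
  intro a b h
  rw [vlift_eq, vlift_eq] at h
  exact congrArg Prod.snd h

theorem vlift_add (w : TangentBundle 𝓘(ℝ, E) M) (a b) : vlift w (a + b) = vlift w a + vlift w b := by
  rw [vlift_eq, vlift_eq, vlift_eq]
  exact Prod.ext (add_zero (0:E)).symm rfl

theorem vliftInv_vlift (w : TangentBundle 𝓘(ℝ, E) M) (a) : vliftInv w (vlift w a) = a :=
  Function.leftInverse_invFun (vlift_inj w) a

theorem vlift_vliftInv (w : TangentBundle 𝓘(ℝ, E) M) (ξ : TangentSpace 𝓘(ℝ, E).tangent w) (h : IsVertical ξ) :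
    vlift w (vliftInv w ξ) = ξ := by
  apply Function.invFun_eq
  refine ⟨(show E × E from ξ).2, ?_⟩
  refine (vlift_eq w _).trans ?_
  refine Prod.ext ?_ rfl
  have : dproj w ξ = 0 := h
  rw [dproj_eq] at this
  exact this.symm

theorem isVertical_vlift (w : TangentBundle 𝓘(ℝ, E) M) (u) : IsVertical (vlift w u) := by
  rw [IsVertical, dproj_eq, vlift_eq]
  rfl

/-- Horizontal vectors are determined by their projection. -/
theorem horiz_unique (D : VerticalConnection E M) {S : Field E M} (hD : D.IsLift S)
    (w) (hw : w ∈ slit E M) (ξ η : TangentSpace 𝓘(ℝ, E).tangent w) (h1 : IsHorizontal S ξ) (h2 : IsHorizontal S η)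
    (h : dproj w ξ = dproj w η) : ξ = η := by
  have a := (hD.2 w hw ξ).2 h1
  have b := (hD.2 w hw η).2 h2
  have hv : IsVertical (ξ - η) := by rw [IsVertical, map_sub, h, sub_self]
  have := hD.1 w hw _ hv
  rw [map_sub, a, b, sub_zero] at this
  exact (sub_eq_zero.1 this.symm)

/-- In terms of `∇`: `D^wV/dt = i_w⁻¹ (∇V^v/dt)(t₀)`, along any lift of `c` through `w` at `t₀` which
is horizontal at `t₀`. -/
theorem covDeriv_eq (D : VerticalConnection E M) {S : Field E M} (hD : D.IsLift S)
    (c : ℝ → M) (I : Set ℝ) (l V : (t : ℝ) → TangentSpace 𝓘(ℝ, E) (c t)) (t₀ : ℝ) (hl : l t₀ ≠ 0)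
    (hh : IsHorizontal S (liftVelocity c I l t₀))
    (hp : dproj _ (liftVelocity c I l t₀) = velocity c I t₀)
    (hv : IsVertical (D.cov (vliftField (frozen c V t₀)) (⟨c t₀, l t₀⟩ : TangentBundle 𝓘(ℝ, E) M) (liftVelocity c I l t₀))) :
    D.covDeriv S c I t₀ (l t₀) V = vliftInv _ (D.covDerivLift c I l V t₀) := by
  have he := Classical.epsilon_spec (p := fun ξ => IsHorizontal S ξ ∧ dproj (⟨c t₀, l t₀⟩ : TangentBundle 𝓘(ℝ, E) M) ξ = velocity c I t₀) ⟨_, hh, hp⟩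
  have : horizontalLift S (⟨c t₀, l t₀⟩ : TangentBundle 𝓘(ℝ, E) M) (velocity c I t₀) = liftVelocity c I l t₀ :=
    horiz_unique D hD _ hl _ _ he.1 hh (he.2.trans hp.symm)
  rw [VerticalConnection.covDeriv, VerticalConnection.affine, this, VerticalConnection.affineAlong]
  apply vlift_inj
  rw [VerticalConnection.covDerivLift, vlift_add, vlift_vliftInv _ _ hv]
  conv_rhs => rw [← vlift_vliftInv _ _ hv, ← vlift_add, vliftInv_vlift, vlift_add, vlift_vliftInv _ _ hv]

end SprayGeometry

end

/-! Both statements come from evaluating the torsion on a pair $(X,Y)$ with $\mathcal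
J(Y)=V^{\mathfrak v}$. Such a $Y$ exists near every $w$: in natural coordinates $\mathcal
J(a,b)=(0,a)$ and $V^{\mathfrak v}=(0,V)$, so $Y=(V,0)$ works (`coordLift`).

Part 1. Since $\mathcal J(S)=C$, (T1) reads $\nabla_SV^{\mathfrak v}=\nabla_YC+\mathcal J[S,Y]$. For
a lift, $\nabla C$ is the identity on vertical vectors and has the horizontal distribution as
kernel, so it is the vertical projection of $\Gamma_S$. The right side thus involves only $S$ and
$Y$ (`cov_vliftField_spray_eq`). Moreover $S(w)$ is the horizontal lift of $w$ at $w$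
(`IsSpray.horizontalLift_eq`): it projects to $w$, and $\Gamma_S(S)=\mathcal J[S,S]-[S,\mathcal J
S]=[C,S]=S$. Hence $D^w_wV=i_w^{-1}\nabla_{S(w)}V^{\mathfrak v}$ is the same for all such lifts.

Part 2. If $X$ is vertical, then $\mathcal J(X)=0$, and $[X,Y]$ is vertical because $X$ projects to
$0$ and $Y$ to $V$ (`isVertical_bracket`). So (T3) leaves $\nabla_XV^{\mathfrak v}=0$
(`T3.cov_vliftField_eq_zero`), and $\nabla_\xi V^{\mathfrak v}$ depends on $\xi$ only through
$d\pi(\xi)$. The velocity of any lift of $\lambda$ projects to $\dot\lambda$, which settles the case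
of curves. -/

namespace SprayGeometry

variable {E : Type*} [NormedAddCommGroup E] [NormedSpace ℝ E]
  {M : Type*} [TopologicalSpace M] [ChartedSpace E M] [IsManifold 𝓘(ℝ, E) ∞ M]

/-! ### Natural coordinates on `TM` and `T(TM)` -/

/-- The components of `u ∈ T_yM` in the coordinate frame of the preferred chart at `x`. -/
noncomputable def baseCoord (x y : M) (u : TangentSpace 𝓘(ℝ, E) y) : E :=
  (trivializationAt E (TangentSpace 𝓘(ℝ, E)) x (⟨y, u⟩ : TangentBundle 𝓘(ℝ, E) M)).2

/-- The components of `ξ ∈ T_p(TM)` in the coordinate frame of the preferred chart at `w`. -/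
noncomputable def totalCoord (w p : TangentBundle 𝓘(ℝ, E) M)
    (ξ : TangentSpace 𝓘(ℝ, E).tangent p) : E × E :=
  (trivializationAt (E × E) (TangentSpace 𝓘(ℝ, E).tangent) w
    (⟨p, ξ⟩ : TangentBundle 𝓘(ℝ, E).tangent (TangentBundle 𝓘(ℝ, E) M))).2

theorem baseCoord_eq_continuousLinearMapAt {x y : M} (hy : y ∈ (chartAt E x).source)
    (u : TangentSpace 𝓘(ℝ, E) y) :
    baseCoord x y u = (trivializationAt E (TangentSpace 𝓘(ℝ, E)) x).continuousLinearMapAt ℝ y u :=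
  ((trivializationAt E (TangentSpace 𝓘(ℝ, E)) x).coe_linearMapAt_of_mem (R := ℝ) hy ▸ rfl)

/-- Components in the coordinate frame are values of the differential of the chart, so the chain
rule computes $d\pi$ and $i_w$ in coordinates away from the centre of the chart. -/
theorem baseCoord_eq_mfderiv {x y : M} (hy : y ∈ (chartAt E x).source)
    (u : TangentSpace 𝓘(ℝ, E) y) :
    baseCoord x y u = mfderiv 𝓘(ℝ, E) 𝓘(ℝ, E) (extChartAt 𝓘(ℝ, E) x) y u := by
  rw [baseCoord_eq_continuousLinearMapAt hy, TangentBundle.continuousLinearMapAt_trivializationAt hy]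
  rfl

theorem mem_chart_source_of_fst {w p : TangentBundle 𝓘(ℝ, E) M}
    (hp : p.1 ∈ (chartAt E w.1).source) :
    p ∈ (chartAt (ModelProd E E) w).source :=
  (TangentBundle.mem_chart_source_iff _ _).2 hp

theorem totalCoord_eq_continuousLinearMapAt {w p : TangentBundle 𝓘(ℝ, E) M}
    (hp : p.1 ∈ (chartAt E w.1).source) (ξ : TangentSpace 𝓘(ℝ, E).tangent p) :
    totalCoord w p ξ = (trivializationAt (E × E)
      (TangentSpace 𝓘(ℝ, E).tangent) w).continuousLinearMapAt ℝ p ξ :=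
  ((trivializationAt (E × E) (TangentSpace 𝓘(ℝ, E).tangent) w).coe_linearMapAt_of_mem (R := ℝ)
    (mem_chart_source_of_fst hp) ▸ rfl)

theorem totalCoord_eq_mfderiv {w p : TangentBundle 𝓘(ℝ, E) M}
    (hp : p.1 ∈ (chartAt E w.1).source) (ξ : TangentSpace 𝓘(ℝ, E).tangent p) :
    totalCoord w p ξ =
      mfderiv 𝓘(ℝ, E).tangent 𝓘(ℝ, E × E) (extChartAt 𝓘(ℝ, E).tangent w) p ξ := by
  rw [totalCoord_eq_continuousLinearMapAt hp,
    TangentBundle.continuousLinearMapAt_trivializationAt (mem_chart_source_of_fst hp)]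
  rfl

theorem totalCoord_injective {w p : TangentBundle 𝓘(ℝ, E) M}
    (hp : p.1 ∈ (chartAt E w.1).source) : Function.Injective (totalCoord w p) := by
  intro ξ η h
  rw [totalCoord_eq_continuousLinearMapAt hp, totalCoord_eq_continuousLinearMapAt hp] at h
  have := (trivializationAt (E × E) (TangentSpace 𝓘(ℝ, E).tangent) w).symmL_continuousLinearMapAt
    (R := ℝ) (mem_chart_source_of_fst hp)
  rw [← this ξ, h, this η]

theorem mdifferentiableAt_proj (p : TangentBundle 𝓘(ℝ, E) M) :
    MDifferentiableAt 𝓘(ℝ, E).tangent 𝓘(ℝ, E) (fun q : TangentBundle 𝓘(ℝ, E) M => q.1) p :=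
  (contMDiff_proj (n := 1) (IB := 𝓘(ℝ, E)) (F := E)
    (TangentSpace 𝓘(ℝ, E) (M := M))).contMDiffAt.mdifferentiableAt one_ne_zero

/-- In natural coordinates, `dπ` is the first projection. -/
theorem totalCoord_fst {w p : TangentBundle 𝓘(ℝ, E) M}
    (hp : p.1 ∈ (chartAt E w.1).source) (ξ : TangentSpace 𝓘(ℝ, E).tangent p) :
    (totalCoord w p ξ).1 = baseCoord w.1 p.1 (dproj p ξ) := by
  have h1 : HasMFDerivAt 𝓘(ℝ, E).tangent 𝓘(ℝ, E × E) (extChartAt 𝓘(ℝ, E).tangent w) p _ :=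
    (mdifferentiableAt_extChartAt (mem_chart_source_of_fst hp)).hasMFDerivAt
  have h2 : HasMFDerivAt 𝓘(ℝ, E) 𝓘(ℝ, E) (extChartAt 𝓘(ℝ, E) w.1) p.1 _ :=
    (mdifferentiableAt_extChartAt hp).hasMFDerivAt
  have h3 := HasMFDerivAt.comp p h2 (mdifferentiableAt_proj p).hasMFDerivAt
  have h4 : HasMFDerivAt 𝓘(ℝ, E × E) 𝓘(ℝ, E) (Prod.fst : E × E → E)
      (extChartAt 𝓘(ℝ, E).tangent w p) (ContinuousLinearMap.fst ℝ E E) :=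
    (ContinuousLinearMap.fst ℝ E E).hasFDerivAt.hasMFDerivAt
  have h5 := HasMFDerivAt.comp p h4 h1
  -- `Prod.fst` after the chart of `TM` is definitionally the chart of `M` after the projection, so
  -- both chain rules differentiate the same map.
  have h6 := DFunLike.congr_fun (hasMFDerivAt_unique h5 h3) ξ
  rw [totalCoord_eq_mfderiv hp, baseCoord_eq_mfderiv hp]
  exact h6

theorem baseCoord_add {x y : M} (hy : y ∈ (chartAt E x).source) (u v : TangentSpace 𝓘(ℝ, E) y) :
    baseCoord x y (u + v) = baseCoord x y u + baseCoord x y v := by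
  simp only [baseCoord_eq_continuousLinearMapAt hy, map_add]

theorem baseCoord_smul {x y : M} (hy : y ∈ (chartAt E x).source) (a : ℝ)
    (u : TangentSpace 𝓘(ℝ, E) y) : baseCoord x y (a • u) = a • baseCoord x y u := by
  simp only [baseCoord_eq_continuousLinearMapAt hy, map_smul]

theorem mdifferentiableAt_line (p : TangentBundle 𝓘(ℝ, E) M) (u : TangentSpace 𝓘(ℝ, E) p.1) :
    MDifferentiableAt 𝓘(ℝ, ℝ) 𝓘(ℝ, E).tangent
      (fun t : ℝ => (⟨p.1, p.2 + t • u⟩ : TangentBundle 𝓘(ℝ, E) M)) 0 := by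
  refine ContMDiffAt.mdifferentiableAt (n := 1) ?_ one_ne_zero
  rw [contMDiffAt_totalSpace]
  refine ⟨contMDiffAt_const, ?_⟩
  have h : ∀ t : ℝ, (trivializationAt E (TangentSpace 𝓘(ℝ, E)) p.1
      (⟨p.1, p.2 + t • u⟩ : TangentBundle 𝓘(ℝ, E) M)).2
      = baseCoord p.1 p.1 p.2 + t • baseCoord p.1 p.1 u := by
    intro t
    rw [← baseCoord_smul (mem_chart_source E p.1), ← baseCoord_add (mem_chart_source E p.1)]
    rfl
  refine ContMDiffAt.congr_of_eventuallyEq ?_ (Eventually.of_forall h)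
  exact (contDiffAt_const.add (contDiffAt_id.smul contDiffAt_const)).contMDiffAt

/-- In natural coordinates, the vertical lift is the inclusion of the second factor. -/
theorem totalCoord_vlift {w p : TangentBundle 𝓘(ℝ, E) M}
    (hp : p.1 ∈ (chartAt E w.1).source) (u : TangentSpace 𝓘(ℝ, E) p.1) :
    totalCoord w p (vlift p u) = (0, baseCoord w.1 p.1 u) := by
  have h0 : (⟨p.1, p.2 + (0 : ℝ) • u⟩ : TangentBundle 𝓘(ℝ, E) M) = p := by
    rw [zero_smul, add_zero]
  have h1 : HasMFDerivAt 𝓘(ℝ, E).tangent 𝓘(ℝ, E × E) (extChartAt 𝓘(ℝ, E).tangent w)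
      (⟨p.1, p.2 + (0 : ℝ) • u⟩ : TangentBundle 𝓘(ℝ, E) M)
      (mfderiv 𝓘(ℝ, E).tangent 𝓘(ℝ, E × E) (extChartAt 𝓘(ℝ, E).tangent w)
        (⟨p.1, p.2 + (0 : ℝ) • u⟩ : TangentBundle 𝓘(ℝ, E) M)) :=
    (mdifferentiableAt_extChartAt (mem_chart_source_of_fst
      (p := ⟨p.1, p.2 + (0 : ℝ) • u⟩) hp)).hasMFDerivAt
  have h2 := HasMFDerivAt.comp (0 : ℝ) h1 (mdifferentiableAt_line p u).hasMFDerivAt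
  have hd : HasFDerivAt (fun t : ℝ => (extChartAt 𝓘(ℝ, E) w.1 p.1,
      baseCoord w.1 p.1 p.2 + t • baseCoord w.1 p.1 u))
      ((0 : ℝ →L[ℝ] E).prod ((ContinuousLinearMap.id ℝ ℝ).smulRight (baseCoord w.1 p.1 u))) 0 :=
    (hasFDerivAt_const _ _).prodMk (((hasFDerivAt_id (0 : ℝ)).smul_const _).const_add _)
  have h3 := hd.hasMFDerivAt
  -- The line stays in one fibre, hence in the chart domain for every `t`, and its coordinate
  -- expression is affine.
  have hf : (extChartAt 𝓘(ℝ, E).tangent w) ∘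
      (fun t : ℝ => (⟨p.1, p.2 + t • u⟩ : TangentBundle 𝓘(ℝ, E) M)) =
      fun t : ℝ => (extChartAt 𝓘(ℝ, E) w.1 p.1,
        baseCoord w.1 p.1 p.2 + t • baseCoord w.1 p.1 u) := by
    funext t
    refine Prod.ext rfl ?_
    rw [← baseCoord_smul hp, ← baseCoord_add hp]
    rfl
  rw [hf] at h2
  have h4 := DFunLike.congr_fun (hasMFDerivAt_unique h2 h3) (1 : ℝ)
  have h5 : totalCoord w p (vlift p u) =
      mfderiv 𝓘(ℝ, E).tangent 𝓘(ℝ, E × E) (extChartAt 𝓘(ℝ, E).tangent w)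
        (⟨p.1, p.2 + (0 : ℝ) • u⟩ : TangentBundle 𝓘(ℝ, E) M) (vlift p u) := by
    rw [totalCoord_eq_mfderiv hp, h0]
  rw [h5]
  refine Eq.trans h4 ?_
  exact Prod.ext rfl (one_smul ℝ _)

/-! ### Smoothness in natural coordinates -/

theorem isOpen_preimage_proj {O : Set M} (hO : IsOpen O) :
    IsOpen {p : TangentBundle 𝓘(ℝ, E) M | p.1 ∈ O} :=
  hO.preimage (FiberBundle.continuous_proj E (TangentSpace 𝓘(ℝ, E)))

theorem eventually_fst_mem_chart_source (w : TangentBundle 𝓘(ℝ, E) M) :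
    ∀ᶠ p : TangentBundle 𝓘(ℝ, E) M in 𝓝 w, p.1 ∈ (chartAt E w.1).source :=
  (isOpen_preimage_proj (chartAt E w.1).open_source).mem_nhds (mem_chart_source E w.1)

theorem SmoothOn.contMDiffAt {X : Field E M} {U : Set (TangentBundle 𝓘(ℝ, E) M)}
    (hX : SmoothOn X U) (hU : IsOpen U) {w : TangentBundle 𝓘(ℝ, E) M} (hw : w ∈ U) :
    ContMDiffAt 𝓘(ℝ, E).tangent 𝓘(ℝ, E × E) ∞ (fun p => totalCoord w p (X p)) w :=
  (contMDiffAt_section (E := TangentSpace 𝓘(ℝ, E).tangent) w).1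
    (ContMDiffOn.contMDiffAt hX (hU.mem_nhds hw))

theorem smoothOn_of_totalCoord {X : Field E M} {U : Set (TangentBundle 𝓘(ℝ, E) M)}
    (h : ∀ w ∈ U,
      ContMDiffAt 𝓘(ℝ, E).tangent 𝓘(ℝ, E × E) ∞ (fun p => totalCoord w p (X p)) w) :
    SmoothOn X U := fun w hw =>
  ((contMDiffAt_section (E := TangentSpace 𝓘(ℝ, E).tangent) w).2 (h w hw)).contMDiffWithinAt

theorem SmoothOnBase.contMDiffAt {V : (x : M) → TangentSpace 𝓘(ℝ, E) x} {O : Set M}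
    (hV : SmoothOnBase V O) (hO : IsOpen O) {x : M} (hx : x ∈ O) :
    ContMDiffAt 𝓘(ℝ, E) 𝓘(ℝ, E) ∞ (fun y => baseCoord x y (V y)) x :=
  (contMDiffAt_section (E := TangentSpace 𝓘(ℝ, E)) x).1
    (ContMDiffOn.contMDiffAt hV (hO.mem_nhds hx))

theorem totalCoord_almostTangent {w p : TangentBundle 𝓘(ℝ, E) M}
    (hp : p.1 ∈ (chartAt E w.1).source) (ξ : TangentSpace 𝓘(ℝ, E).tangent p) :
    totalCoord w p (almostTangent p ξ) = (0, (totalCoord w p ξ).1) := by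
  rw [almostTangent, totalCoord_vlift hp, totalCoord_fst hp]

theorem contMDiffAt_proj (w : TangentBundle 𝓘(ℝ, E) M) :
    ContMDiffAt 𝓘(ℝ, E).tangent 𝓘(ℝ, E) ∞ (fun p : TangentBundle 𝓘(ℝ, E) M => p.1) w :=
  (contMDiff_proj (IB := 𝓘(ℝ, E)) (F := E) (TangentSpace 𝓘(ℝ, E) (M := M))).contMDiffAt

theorem _root_.ContMDiffAt.comp_proj {f : M → E} {w : TangentBundle 𝓘(ℝ, E) M}
    (hf : ContMDiffAt 𝓘(ℝ, E) 𝓘(ℝ, E) ∞ f w.1) :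
    ContMDiffAt 𝓘(ℝ, E).tangent 𝓘(ℝ, E) ∞ (fun p : TangentBundle 𝓘(ℝ, E) M => f p.1) w :=
  ContMDiffAt.comp w hf (contMDiffAt_proj w)

theorem _root_.ContMDiffOn.comp_proj {f : M → E} {O : Set M}
    (hf : ContMDiffOn 𝓘(ℝ, E) 𝓘(ℝ, E) ∞ f O) :
    ContMDiffOn 𝓘(ℝ, E).tangent 𝓘(ℝ, E) ∞ (fun p : TangentBundle 𝓘(ℝ, E) M => f p.1)
      {p | p.1 ∈ O} :=
  ContMDiffOn.comp hf (fun p _ => (contMDiffAt_proj p).contMDiffWithinAt) fun _ hp => hp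

theorem smoothOn_almostTangentField {X : Field E M} {U : Set (TangentBundle 𝓘(ℝ, E) M)}
    (hU : IsOpen U) (hX : SmoothOn X U) : SmoothOn (almostTangentField X) U := by
  refine smoothOn_of_totalCoord fun w hw => ?_
  refine ContMDiffAt.congr_of_eventuallyEq
    (f := fun p => ((0 : E), (totalCoord w p (X p)).1)) ?_ ?_
  · exact ContMDiffAt.prodMk_space contMDiffAt_const
      ((contDiff_fst (𝕜 := ℝ) (E := E) (F := E)).contMDiff.contMDiffAt.comp w
        (hX.contMDiffAt hU hw))
  · filter_upwards [eventually_fst_mem_chart_source w] with p hp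
      using totalCoord_almostTangent hp _

theorem smoothOn_vliftField {V : (x : M) → TangentSpace 𝓘(ℝ, E) x} {O : Set M}
    (hO : IsOpen O) (hV : SmoothOnBase V O) :
    SmoothOn (vliftField V) {p : TangentBundle 𝓘(ℝ, E) M | p.1 ∈ O} := by
  refine smoothOn_of_totalCoord fun w hw => ?_
  refine ContMDiffAt.congr_of_eventuallyEq
    (f := fun p => ((0 : E), baseCoord w.1 p.1 (V p.1))) ?_ ?_
  · exact ContMDiffAt.prodMk_space contMDiffAt_const
      (ContMDiffAt.comp_proj (f := fun y => baseCoord w.1 y (V y)) (hV.contMDiffAt hO hw))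
  · filter_upwards [eventually_fst_mem_chart_source w] with p hp using totalCoord_vlift hp _

theorem contMDiffAt_baseCoord_snd (w : TangentBundle 𝓘(ℝ, E) M) :
    ContMDiffAt 𝓘(ℝ, E).tangent 𝓘(ℝ, E) ∞
      (fun p : TangentBundle 𝓘(ℝ, E) M => baseCoord w.1 p.1 p.2) w :=
  ((contMDiffAt_totalSpace (f := fun p : TangentBundle 𝓘(ℝ, E) M => p)).1 contMDiffAt_id).2

theorem smoothOn_canonicalField (U : Set (TangentBundle 𝓘(ℝ, E) M)) :
    SmoothOn (canonicalField E M) U := by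
  refine smoothOn_of_totalCoord fun w hw => ?_
  refine ContMDiffAt.congr_of_eventuallyEq
    (f := fun p => ((0 : E), baseCoord w.1 p.1 p.2)) ?_ ?_
  · exact ContMDiffAt.prodMk_space contMDiffAt_const
      (contMDiffAt_baseCoord_snd w)
  · filter_upwards [eventually_fst_mem_chart_source w] with p hp using totalCoord_vlift hp _

theorem isVerticalSectionOn_vliftField {V : (x : M) → TangentSpace 𝓘(ℝ, E) x} {O : Set M}
    (hO : IsOpen O) (hV : SmoothOnBase V O) {U : Set (TangentBundle 𝓘(ℝ, E) M)}
    (hU : ∀ p ∈ U, p.1 ∈ O) : IsVerticalSectionOn (vliftField V) U :=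
  ⟨ContMDiffOn.mono (smoothOn_vliftField hO hV) hU, fun w _ => isVertical_vlift w _⟩

theorem isVerticalSectionOn_canonicalField (U : Set (TangentBundle 𝓘(ℝ, E) M)) :
    IsVerticalSectionOn (canonicalField E M) U :=
  ⟨smoothOn_canonicalField U, fun w _ => isVertical_vlift w _⟩

/-- The fibre coordinate is continuous, so it stays nonzero near `w`. -/
theorem isOpen_slit : IsOpen (slit E M) := by
  refine isOpen_iff_mem_nhds.2 fun w hw => ?_
  have h0 : baseCoord w.1 w.1 w.2 ≠ 0 := by
    rw [baseCoord, triv_self]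
    exact hw
  filter_upwards [(contMDiffAt_baseCoord_snd w).continuousAt.eventually_ne h0,
    eventually_fst_mem_chart_source w] with p hp hpw hp0
  refine hp ?_
  rw [hp0, baseCoord_eq_continuousLinearMapAt hpw, map_zero]

/-! ### Local extensions with prescribed coordinates -/

/-- The field on `TM` which in the natural coordinates at `w` is `(V, 0)`. -/
noncomputable def coordLift (w : TangentBundle 𝓘(ℝ, E) M) (V : (x : M) → TangentSpace 𝓘(ℝ, E) x) :
    Field E M := fun p =>
  (trivializationAt (E × E) (TangentSpace 𝓘(ℝ, E).tangent) w).symm p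
    (baseCoord w.1 p.1 (V p.1), 0)

theorem totalCoord_symm {w p : TangentBundle 𝓘(ℝ, E) M} (hp : p.1 ∈ (chartAt E w.1).source)
    (z : E × E) : totalCoord w p
      ((trivializationAt (E × E) (TangentSpace 𝓘(ℝ, E).tangent) w).symm p z) = z := by
  rw [totalCoord, Trivialization.apply_mk_symm _ (mem_chart_source_of_fst hp)]

theorem totalCoord_coordLift {w p : TangentBundle 𝓘(ℝ, E) M}
    (hp : p.1 ∈ (chartAt E w.1).source) (V : (x : M) → TangentSpace 𝓘(ℝ, E) x) :
    totalCoord w p (coordLift w V p) = (baseCoord w.1 p.1 (V p.1), 0) :=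
  totalCoord_symm hp _

/-- Serves fields defined through the frame of one chart, where recentring the coordinates at each
point would bring in transition maps. -/
theorem smoothOn_of_totalCoord_fixed {X : Field E M} {U : Set (TangentBundle 𝓘(ℝ, E) M)}
    (w : TangentBundle 𝓘(ℝ, E) M) (hU : IsOpen U) (hw : ∀ p ∈ U, p.1 ∈ (chartAt E w.1).source)
    (h : ContMDiffOn 𝓘(ℝ, E).tangent 𝓘(ℝ, E × E) ∞ (fun p => totalCoord w p (X p)) U) :
    SmoothOn X U :=
  ((trivializationAt (E × E) (TangentSpace 𝓘(ℝ, E).tangent) w).contMDiffOn_section_iff hU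
    (fun p hp => mem_chart_source_of_fst (hw p hp))).2 h

theorem smoothOn_coordLift (w : TangentBundle 𝓘(ℝ, E) M)
    {V : (x : M) → TangentSpace 𝓘(ℝ, E) x} {O : Set M} (hO : IsOpen O) (hV : SmoothOnBase V O)
    (hw : O ⊆ (chartAt E w.1).source) :
    SmoothOn (coordLift w V) {p : TangentBundle 𝓘(ℝ, E) M | p.1 ∈ O} := by
  refine smoothOn_of_totalCoord_fixed w (isOpen_preimage_proj hO) (fun p hp => hw hp) ?_
  have h : ContMDiffOn 𝓘(ℝ, E) 𝓘(ℝ, E) ∞ (fun y => baseCoord w.1 y (V y)) O :=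
    ((trivializationAt E (TangentSpace 𝓘(ℝ, E)) w.1).contMDiffOn_section_iff hO hw).1 hV
  have h' : ContMDiffOn 𝓘(ℝ, E).tangent 𝓘(ℝ, E × E) ∞
      (fun p : TangentBundle 𝓘(ℝ, E) M => (baseCoord w.1 p.1 (V p.1), (0 : E))) {p | p.1 ∈ O} :=
    ContMDiffOn.prodMk_space (ContMDiffOn.comp_proj h) contMDiffOn_const
  exact h'.congr fun p hp => totalCoord_coordLift (hw hp) V

theorem almostTangent_coordLift {w p : TangentBundle 𝓘(ℝ, E) M}
    (hp : p.1 ∈ (chartAt E w.1).source) (V : (x : M) → TangentSpace 𝓘(ℝ, E) x) :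
    almostTangent p (coordLift w V p) = vliftField V p := by
  refine totalCoord_injective hp ?_
  rw [totalCoord_almostTangent hp, totalCoord_coordLift hp, vliftField, totalCoord_vlift hp]

theorem totalCoord_extend {w p : TangentBundle 𝓘(ℝ, E) M} (hp : p.1 ∈ (chartAt E w.1).source)
    (ξ : TangentSpace 𝓘(ℝ, E).tangent w) :
    totalCoord w p (FiberBundle.extend (E × E) ξ p) = totalCoord w w ξ :=
  totalCoord_symm hp _

theorem isVertical_iff_totalCoord {w p : TangentBundle 𝓘(ℝ, E) M}
    (hp : p.1 ∈ (chartAt E w.1).source) (ξ : TangentSpace 𝓘(ℝ, E).tangent p) :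
    IsVertical ξ ↔ (totalCoord w p ξ).1 = 0 := by
  rw [totalCoord_fst hp, IsVertical, baseCoord_eq_continuousLinearMapAt hp]
  constructor
  · intro h
    rw [h, map_zero]
  · intro h
    rw [← (trivializationAt E (TangentSpace 𝓘(ℝ, E)) w.1).symmL_continuousLinearMapAt
      (R := ℝ) hp (dproj p ξ), h, map_zero]

theorem smoothOnBase_extend {x : M} (u : TangentSpace 𝓘(ℝ, E) x) :
    SmoothOnBase (FiberBundle.extend E u) (chartAt E x).source := by
  refine ((trivializationAt E (TangentSpace 𝓘(ℝ, E)) x).contMDiffOn_section_iff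
    (chartAt E x).open_source subset_rfl).2 ?_
  refine ContMDiffOn.congr (f := fun _ => baseCoord x x u) contMDiffOn_const fun y hy => ?_
  rw [FiberBundle.extend, Trivialization.apply_mk_symm _ hy]
  rfl

theorem smoothOn_extend {w : TangentBundle 𝓘(ℝ, E) M} (ξ : TangentSpace 𝓘(ℝ, E).tangent w) :
    SmoothOn (FiberBundle.extend (E × E) ξ)
      {p : TangentBundle 𝓘(ℝ, E) M | p.1 ∈ (chartAt E w.1).source} :=
  smoothOn_of_totalCoord_fixed w (isOpen_preimage_proj (chartAt E w.1).open_source)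
    (fun _ hp => hp)
    (ContMDiffOn.congr (f := fun _ => totalCoord w w ξ) contMDiffOn_const
      fun _ hp => totalCoord_extend hp ξ)

/-! ### Algebra of the almost-tangent structure -/

theorem almostTangent_add (w : TangentBundle 𝓘(ℝ, E) M) (ξ η : TangentSpace 𝓘(ℝ, E).tangent w) :
    almostTangent w (ξ + η) = almostTangent w ξ + almostTangent w η := by
  rw [almostTangent, map_add, vlift_add]
  rfl

theorem vlift_smul (w : TangentBundle 𝓘(ℝ, E) M) (a : ℝ) (u : TangentSpace 𝓘(ℝ, E) w.1) :
    vlift w (a • u) = a • vlift w u := by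
  rw [vlift_eq, vlift_eq]
  exact Prod.ext (smul_zero a).symm rfl

theorem almostTangent_smul (w : TangentBundle 𝓘(ℝ, E) M) (a : ℝ)
    (ξ : TangentSpace 𝓘(ℝ, E).tangent w) :
    almostTangent w (a • ξ) = a • almostTangent w ξ := by
  rw [almostTangent, map_smul, vlift_smul]
  rfl

theorem almostTangent_eq_zero {w : TangentBundle 𝓘(ℝ, E) M} {ξ : TangentSpace 𝓘(ℝ, E).tangent w}
    (h : IsVertical ξ) : almostTangent w ξ = 0 := by
  have h0 : dproj w ξ = 0 := h
  rw [almostTangent, h0, ← zero_smul ℝ (0 : TangentSpace 𝓘(ℝ, E) w.1), vlift_smul, zero_smul]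

theorem dproj_eq_of_almostTangent_eq {w : TangentBundle 𝓘(ℝ, E) M}
    {ξ : TangentSpace 𝓘(ℝ, E).tangent w} {u : TangentSpace 𝓘(ℝ, E) w.1}
    (h : almostTangent w ξ = vlift w u) : dproj w ξ = u :=
  vlift_inj w h

/-! ### Brackets of vertical and projectable fields -/

/-- In the chart domain, the coordinate representation of a field given by `mpullbackWithin`
consists of its components in the coordinate frame. -/
theorem mpullbackWithin_extChartAt_symm_eq {w : TangentBundle 𝓘(ℝ, E) M} (X : Field E M)
    {z : E × E} (hz : z ∈ (extChartAt 𝓘(ℝ, E).tangent w).target) :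
    VectorField.mpullbackWithin 𝓘(ℝ, E × E) 𝓘(ℝ, E).tangent (extChartAt 𝓘(ℝ, E).tangent w).symm X
        (range 𝓘(ℝ, E).tangent) z =
      totalCoord w ((extChartAt 𝓘(ℝ, E).tangent w).symm z)
        (X ((extChartAt 𝓘(ℝ, E).tangent w).symm z)) := by
  have hp : ((extChartAt 𝓘(ℝ, E).tangent w).symm z).1 ∈ (chartAt E w.1).source := by
    rw [← TangentBundle.mem_chart_source_iff, ← extChartAt_source 𝓘(ℝ, E).tangent]
    exact (extChartAt 𝓘(ℝ, E).tangent w).map_target hz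
  rw [totalCoord_eq_mfderiv hp, VectorField.mpullbackWithin_apply]
  refine (isInvertible_mfderivWithin_extChartAt_symm hz).inverse_apply_eq.2 ?_
  exact (DFunLike.congr_fun (mfderivWithin_extChartAt_symm_comp_mfderiv_extChartAt hz)
    (X ((extChartAt 𝓘(ℝ, E).tangent w).symm z))).symm

/-- In $[A,B]=DB(A)-DA(B)$ the first component of $DA(B)$ vanishes because that of $A$ is locally
zero. Moving along $A(z)$ fixes the first coordinate, on which alone the first component of $B$
depends. Differentiating along the line $z+tA(z)$ avoids any differentiability assumption on `h`. -/
theorem fst_lieBracket_eq_zero {A B : E × E → E × E} {z : E × E} {h : E → E}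
    (hA : DifferentiableAt ℝ A z) (hB : DifferentiableAt ℝ B z)
    (hA0 : ∀ᶠ y in 𝓝 z, (A y).1 = 0) (hB0 : ∀ᶠ y in 𝓝 z, (B y).1 = h y.1) :
    (VectorField.lieBracket ℝ A B z).1 = 0 := by
  have h1 : HasFDerivAt (fun y => (A y).1) ((ContinuousLinearMap.fst ℝ E E).comp (fderiv ℝ A z)) z :=
    (ContinuousLinearMap.fst ℝ E E).hasFDerivAt.comp z hA.hasFDerivAt
  have h1' : HasFDerivAt (fun y => (A y).1) (0 : E × E →L[ℝ] E) z :=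
    (hasFDerivAt_const (0 : E) z).congr_of_eventuallyEq hA0
  have h2 := DFunLike.congr_fun (h1.unique h1') (B z)
  have h3 : HasFDerivAt (fun y => (B y).1) ((ContinuousLinearMap.fst ℝ E E).comp (fderiv ℝ B z)) z :=
    (ContinuousLinearMap.fst ℝ E E).hasFDerivAt.comp z hB.hasFDerivAt
  have h4 : HasDerivAt (fun t : ℝ => z + t • A z) (A z) 0 := by
    simpa using ((hasDerivAt_id (0 : ℝ)).smul_const (A z)).const_add z
  have h5 : HasDerivAt (fun t : ℝ => (B (z + t • A z)).1) (fderiv ℝ B z (A z)).1 0 := by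
    refine HasFDerivAt.comp_hasDerivAt (0 : ℝ) (l := fun y => (B y).1)
      (l' := (ContinuousLinearMap.fst ℝ E E).comp (fderiv ℝ B z))
      (f := fun t : ℝ => z + t • A z) ?_ h4
    rw [zero_smul, add_zero]
    exact h3
  have h6 : HasDerivAt (fun t : ℝ => (B (z + t • A z)).1) 0 0 := by
    refine (hasDerivAt_const (0 : ℝ) (h z.1)).congr_of_eventuallyEq ?_
    have hc : Tendsto (fun t : ℝ => z + t • A z) (𝓝 0) (𝓝 z) := by
      simpa using h4.continuousAt.tendsto
    filter_upwards [hc.eventually hB0] with t ht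
    rw [ht, Prod.fst_add, Prod.smul_fst, hA0.self_of_nhds, smul_zero, add_zero]
  rw [VectorField.lieBracket_eq]
  show (fderiv ℝ B z (A z)).1 - (fderiv ℝ A z (B z)).1 = 0
  rw [h5.unique h6, zero_sub, neg_eq_zero]
  exact h2

/-- The bracket of a vertical field with a projectable field is vertical. -/
theorem isVertical_bracket [CompleteSpace E] {w : TangentBundle 𝓘(ℝ, E) M} {X Y : Field E M}
    {U : Set (TangentBundle 𝓘(ℝ, E) M)} (hU : IsOpen U) (hw : w ∈ U)
    (hX : SmoothOn X U) (hY : SmoothOn Y U)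
    (hXv : ∀ p ∈ U, IsVertical (X p)) {V : (x : M) → TangentSpace 𝓘(ℝ, E) x}
    (hYV : ∀ p ∈ U, dproj p (Y p) = V p.1) : IsVertical (bracket X Y w) := by
  have hd : ∀ {Z : Field E M}, SmoothOn Z U → DifferentiableAt ℝ
      (VectorField.mpullbackWithin 𝓘(ℝ, E × E) 𝓘(ℝ, E).tangent
        (extChartAt 𝓘(ℝ, E).tangent w).symm Z (range 𝓘(ℝ, E).tangent))
      (extChartAt 𝓘(ℝ, E).tangent w w) := by
    intro Z hZ
    have h : MDifferentiableAt 𝓘(ℝ, E).tangent 𝓘(ℝ, E).tangent.tangent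
        (fun p => (⟨p, Z p⟩ : TangentBundle 𝓘(ℝ, E).tangent (TangentBundle 𝓘(ℝ, E) M))) w :=
      (ContMDiffOn.contMDiffAt hZ (hU.mem_nhds hw)).mdifferentiableAt (by simp)
    have h' := (mdifferentiableWithinAt_univ.2
      h).differentiableWithinAt_mpullbackWithin_vectorField
    rw [preimage_univ, univ_inter] at h'
    refine DifferentiableWithinAt.differentiableAt h' ?_
    rw [ModelWithCorners.range_eq_univ]
    exact univ_mem
  have ht : ∀ᶠ z in 𝓝 (extChartAt 𝓘(ℝ, E).tangent w w),
      z ∈ (extChartAt 𝓘(ℝ, E).tangent w).target :=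
    extChartAt_target_mem_nhds w
  have hs : ∀ᶠ z in 𝓝 (extChartAt 𝓘(ℝ, E).tangent w w),
      (extChartAt 𝓘(ℝ, E).tangent w).symm z ∈ U := by
    refine (continuousAt_extChartAt_symm w).eventually ?_
    rw [extChartAt_to_inv]
    exact hU.mem_nhds hw
  have hp : ∀ z ∈ (extChartAt 𝓘(ℝ, E).tangent w).target,
      ((extChartAt 𝓘(ℝ, E).tangent w).symm z).1 ∈ (chartAt E w.1).source := by
    intro z hz
    rw [← TangentBundle.mem_chart_source_iff, ← extChartAt_source 𝓘(ℝ, E).tangent]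
    exact (extChartAt 𝓘(ℝ, E).tangent w).map_target hz
  -- Here `h` is the coordinate expression of `V` in the base chart.
  have key := fst_lieBracket_eq_zero
    (h := fun y => baseCoord w.1 ((extChartAt 𝓘(ℝ, E) w.1).symm y)
      (V ((extChartAt 𝓘(ℝ, E) w.1).symm y))) (hd hX) (hd hY)
    (by
      filter_upwards [ht, hs] with z hz hzU
      rw [mpullbackWithin_extChartAt_symm_eq X hz]
      exact (isVertical_iff_totalCoord (hp z hz) _).1 (hXv _ hzU))
    (by
      filter_upwards [ht, hs] with z hz hzU
      rw [mpullbackWithin_extChartAt_symm_eq Y hz, totalCoord_fst (hp z hz), hYV _ hzU]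
      have h1 : (extChartAt 𝓘(ℝ, E) w.1).symm z.1 = ((extChartAt 𝓘(ℝ, E).tangent w).symm z).1 := by
        conv_lhs => rw [← (extChartAt 𝓘(ℝ, E).tangent w).right_inv hz]
        exact (extChartAt 𝓘(ℝ, E) w.1).left_inv (by
          rw [extChartAt_source]
          exact hp z hz)
      rw [h1])
  rw [isVertical_iff_totalCoord (mem_chart_source E w.1), totalCoord_eq_mfderiv
    (mem_chart_source E w.1), bracket, VectorField.mlieBracket,
    VectorField.mlieBracketWithin_apply, preimage_univ, univ_inter]
  -- The bracket on the manifold is the chart bracket carried back by the inverse of the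
  -- differential of the chart; taking components undoes this.
  refine Eq.trans (congrArg Prod.fst ((isInvertible_mfderiv_extChartAt
    (mem_extChartAt_source w)).self_apply_inverse _)) ?_
  have hr : ∀ A B : E × E → E × E, VectorField.lieBracketWithin ℝ A B (range 𝓘(ℝ, E).tangent) =
      VectorField.lieBracket ℝ A B := by
    intro A B
    rw [ModelWithCorners.range_eq_univ]
    exact VectorField.lieBracketWithin_univ
  exact (congrArg Prod.fst (congrFun (hr _ _) _)).trans key

/-! ### Tensoriality of the canonical connection -/

/-- Replacing $X$ by $fX$ produces the extra term $(Sf)\mathcal J(X)$ in both summands, and these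
cancel. This allows $\Gamma_S$, defined through an extension with constant coefficients, to be
evaluated on $S$ itself. -/
theorem tensorialAt_canonicalConnection [FiniteDimensional ℝ E] (S : Field E M)
    (w : TangentBundle 𝓘(ℝ, E) M) : TensorialAt 𝓘(ℝ, E).tangent (E × E)
      (fun X : Field E M => almostTangent w (bracket S X w) - bracket S (almostTangentField X) w)
      w := by
  have hJ : ∀ {X : Field E M}, MDifferentiableAt 𝓘(ℝ, E).tangent 𝓘(ℝ, E).tangent.tangent
      (fun p => (⟨p, X p⟩ : TangentBundle 𝓘(ℝ, E).tangent (TangentBundle 𝓘(ℝ, E) M))) w →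
      MDifferentiableAt 𝓘(ℝ, E).tangent 𝓘(ℝ, E).tangent.tangent (fun p =>
        (⟨p, almostTangentField X p⟩ :
          TangentBundle 𝓘(ℝ, E).tangent (TangentBundle 𝓘(ℝ, E) M))) w := by
    intro X hX
    have h1 : MDifferentiableAt 𝓘(ℝ, E).tangent 𝓘(ℝ, E × E) (fun p => totalCoord w p (X p)) w :=
      (mdifferentiableAt_section (E := TangentSpace 𝓘(ℝ, E).tangent) _ X).1 hX
    refine (mdifferentiableAt_section (E := TangentSpace 𝓘(ℝ, E).tangent) _ _).2 ?_
    have h2 : MDifferentiableAt 𝓘(ℝ, E).tangent 𝓘(ℝ, E × E)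
        (fun p => ((ContinuousLinearMap.inr ℝ E E).comp (ContinuousLinearMap.fst ℝ E E))
          (totalCoord w p (X p))) w :=
      (ContinuousLinearMap.mdifferentiableAt _).comp w h1
    refine h2.congr_of_eventuallyEq ?_
    filter_upwards [eventually_fst_mem_chart_source w] with p hp
      using totalCoord_almostTangent hp _
  constructor
  · intro f X hf hX
    have h1 := VectorField.mlieBracket_smul_right (V := S) hf hX
    have h2 := VectorField.mlieBracket_smul_right (V := S) hf (hJ hX)
    have h3 : almostTangentField (f • X) = f • almostTangentField X := by
      funext p
      exact almostTangent_smul p _ _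
    rw [h3, bracket, bracket, h1, h2, almostTangent_add, almostTangent_smul, almostTangent_smul,
      smul_sub, almostTangentField, bracket, bracket]
    abel
  · intro X Y hX hY
    have h1 := VectorField.mlieBracket_add_right (V := S) hX hY
    have h2 := VectorField.mlieBracket_add_right (V := S) (hJ hX) (hJ hY)
    have h3 : almostTangentField (X + Y) = almostTangentField X + almostTangentField Y := by
      funext p
      exact almostTangent_add p _ _
    rw [h3, bracket, bracket, h1, h2, almostTangent_add, bracket, bracket, bracket, bracket]
    abel

/-- A spray is horizontal. -/
theorem IsSpray.isHorizontal [FiniteDimensional ℝ E] {S : Field E M} (hS : IsSpray S)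
    {w : TangentBundle 𝓘(ℝ, E) M} (hw : w ∈ slit E M) : IsHorizontal S (S w) := by
  have hSw : MDifferentiableAt 𝓘(ℝ, E).tangent 𝓘(ℝ, E).tangent.tangent
      (fun p => (⟨p, S p⟩ : TangentBundle 𝓘(ℝ, E).tangent (TangentBundle 𝓘(ℝ, E) M))) w :=
    (ContMDiffOn.contMDiffAt hS.smooth (isOpen_slit.mem_nhds hw)).mdifferentiableAt (by simp)
  -- The constant extension of `S w` is replaced by `S`, for which $[S,S]=0$ and $\mathcal J(S)=C$
  -- near `w`.
  have h := (tensorialAt_canonicalConnection S w).pointwise (σ := FiberBundle.extend (E × E) (S w))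
    (FiberBundle.mdifferentiableAt_extend _ _ _) hSw (FiberBundle.extend_apply_self _ _)
  have hJS : almostTangentField S =ᶠ[𝓝 w] canonicalField E M := by
    filter_upwards [isOpen_slit.mem_nhds hw] with p hp using hS.second_order p hp
  have h1 : bracket S (almostTangentField S) w = bracket S (canonicalField E M) w :=
    Filter.EventuallyEq.mlieBracket_vectorField_eq (EventuallyEq.refl _ _) hJS
  refine h.trans ?_
  have h2 : bracket S (canonicalField E M) w = - bracket (canonicalField E M) S w :=
    VectorField.mlieBracket_swap_apply
  have h3 : bracket S S w = 0 := congrFun VectorField.mlieBracket_self w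
  rw [h1, h2, hS.homogeneous w hw, h3, almostTangent_eq_zero (map_zero _), zero_sub, neg_neg]

/-! ### Locality of connections; lifts of the canonical connection -/

/-- `∇Y` at `w` depends only on the germ of `Y` at `w`. -/
theorem VerticalConnection.cov_congr (D : VerticalConnection E M)
    {U : Set (TangentBundle 𝓘(ℝ, E) M)} (hUs : U ⊆ slit E M) (hU : IsOpen U) {Y Z : Field E M}
    (hY : IsVerticalSectionOn Y U) (hZ : IsVerticalSectionOn Z U) (h : ∀ p ∈ U, Y p = Z p)
    {w : TangentBundle 𝓘(ℝ, E) M} (hw : w ∈ U) (ξ : TangentSpace 𝓘(ℝ, E).tangent w) :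
    D.cov Y w ξ = D.cov Z w ξ := by
  classical
  -- The indicator of `U` serves as cutoff: the Leibniz rule asks for smoothness only on `U`, where
  -- it is constantly 1, and it makes the two sections equal everywhere.
  let f : TangentBundle 𝓘(ℝ, E) M → ℝ := fun p => if p ∈ U then 1 else 0
  have hf1 : ∀ p ∈ U, f p = 1 := fun p hp => if_pos hp
  have hf : ContMDiffOn 𝓘(ℝ, E).tangent 𝓘(ℝ, ℝ) ∞ f U :=
    ContMDiffOn.congr (f := fun _ => (1 : ℝ)) contMDiffOn_const hf1
  have hd : mvfderiv 𝓘(ℝ, E).tangent f w = 0 := by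
    have h1 : f =ᶠ[𝓝 w] fun _ => (1 : ℝ) := by
      filter_upwards [hU.mem_nhds hw] with p hp using hf1 p hp
    have h2 : mfderiv 𝓘(ℝ, E).tangent 𝓘(ℝ, ℝ) f w = 0 := by
      rw [h1.mfderiv_eq, mfderiv_const]
      rfl
    ext v
    simp [mvfderiv, h2]
  have hcut : ∀ {X : Field E M}, IsVerticalSectionOn X U →
      D.cov (fun p => f p • X p) w ξ = D.cov X w ξ := by
    intro X hX
    rw [D.leibniz U hUs hU X hX f hf w hw, hd, hf1 w hw, one_smul]
    simp
  have hYZ : (fun p => f p • Y p) = fun p => f p • Z p := by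
    funext p
    by_cases hp : p ∈ U
    · rw [h p hp]
    · simp only [f, if_neg hp, zero_smul]
  rw [← hcut hY, hYZ, hcut hZ]

/-- On `U` the section agrees with `0 • Y`, which the Leibniz rule sends to zero. -/
theorem VerticalConnection.cov_eq_zero (D : VerticalConnection E M)
    {U : Set (TangentBundle 𝓘(ℝ, E) M)} (hUs : U ⊆ slit E M) (hU : IsOpen U) {Y : Field E M}
    (hY : IsVerticalSectionOn Y U) (h : ∀ p ∈ U, Y p = 0)
    {w : TangentBundle 𝓘(ℝ, E) M} (hw : w ∈ U) (ξ : TangentSpace 𝓘(ℝ, E).tangent w) :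
    D.cov Y w ξ = 0 := by
  have h0 : ∀ p ∈ U, (0 : ℝ) • Y p = Y p := fun p hp => by rw [h p hp, smul_zero]
  have hZ : IsVerticalSectionOn (fun p => (0 : ℝ) • Y p) U := by
    refine ⟨ContMDiffOn.congr hY.1 fun p hp => congrArg
      (fun v => (⟨p, v⟩ : TangentBundle 𝓘(ℝ, E).tangent (TangentBundle 𝓘(ℝ, E) M))) (h0 p hp), fun p hp => ?_⟩
    show IsVertical ((0 : ℝ) • Y p)
    rw [h0 p hp]
    exact hY.2 p hp
  rw [← D.cov_congr hUs hU hZ hY h0 hw ξ,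
    D.leibniz U hUs hU Y hY (fun _ => 0) contMDiffOn_const w hw ξ]
  simp [mvfderiv]

theorem VerticalConnection.isVertical_cov_canonicalField (D : VerticalConnection E M)
    {w : TangentBundle 𝓘(ℝ, E) M} (hw : w ∈ slit E M) (ξ : TangentSpace 𝓘(ℝ, E).tangent w) :
    IsVertical (D.cov (canonicalField E M) w ξ) :=
  D.vertical _ subset_rfl isOpen_slit _ (isVerticalSectionOn_canonicalField _) w hw ξ

/-- $\nabla_\xi C$ is vertical, so $\nabla C$ fixes it: $\nabla C$ is idempotent, and
$\xi-\nabla_\xi C$ lies in its kernel. -/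
theorem VerticalConnection.IsLift.isHorizontal_sub {D : VerticalConnection E M} {S : Field E M}
    (hD : D.IsLift S) {w : TangentBundle 𝓘(ℝ, E) M} (hw : w ∈ slit E M)
    (ξ : TangentSpace 𝓘(ℝ, E).tangent w) :
    IsHorizontal S (ξ - D.cov (canonicalField E M) w ξ) := by
  rw [← hD.2 w hw, map_sub, hD.1 w hw _ (D.isVertical_cov_canonicalField hw ξ), sub_self]

/-- `∇C` is the same for all lifts of `Γ_S`: it is the vertical projection. -/
theorem VerticalConnection.IsLift.cov_canonicalField_eq {D D' : VerticalConnection E M}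
    {S : Field E M} (hD : D.IsLift S) (hD' : D'.IsLift S) {w : TangentBundle 𝓘(ℝ, E) M}
    (hw : w ∈ slit E M) (ξ : TangentSpace 𝓘(ℝ, E).tangent w) :
    D.cov (canonicalField E M) w ξ = D'.cov (canonicalField E M) w ξ := by
  -- Horizontality refers to `S` alone, so the horizontal part found with `D` is also killed by
  -- `D'`.
  have h := (hD'.2 w hw _).2 (hD.isHorizontal_sub hw ξ)
  rw [map_sub, hD'.1 w hw _ (D.isVertical_cov_canonicalField hw ξ), sub_eq_zero] at h
  exact h.symm

theorem dproj_surjective (w : TangentBundle 𝓘(ℝ, E) M) : Function.Surjective (dproj w) :=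
  fun u => ⟨((u : E), (0 : E)), dproj_eq w _⟩

/-- Subtracting the vertical part from any preimage of `u` gives the horizontal vector required by
`Classical.epsilon`. -/
theorem VerticalConnection.IsLift.horizontalLift_spec {D : VerticalConnection E M} {S : Field E M}
    (hD : D.IsLift S) {w : TangentBundle 𝓘(ℝ, E) M} (hw : w ∈ slit E M)
    (u : TangentSpace 𝓘(ℝ, E) w.1) :
    IsHorizontal S (horizontalLift S w u) ∧ dproj w (horizontalLift S w u) = u := by
  obtain ⟨ξ, rfl⟩ := dproj_surjective w u
  refine Classical.epsilon_spec (p := fun η => IsHorizontal S η ∧ dproj w η = dproj w ξ)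
    ⟨_, hD.isHorizontal_sub hw ξ, ?_⟩
  have h : dproj w (D.cov (canonicalField E M) w ξ) = 0 := D.isVertical_cov_canonicalField hw ξ
  rw [map_sub, h, sub_zero]

theorem IsSpray.horizontalLift_eq [FiniteDimensional ℝ E] {S : Field E M} (hS : IsSpray S)
    {D : VerticalConnection E M} (hD : D.IsLift S) {w : TangentBundle 𝓘(ℝ, E) M}
    (hw : w ∈ slit E M) : horizontalLift S w w.2 = S w :=
  have h := hD.horizontalLift_spec hw w.2
  horiz_unique D hD w hw _ _ h.1 (hS.isHorizontal hw)
    (h.2.trans (dproj_eq_of_almostTangent_eq (hS.second_order w hw)).symm)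

/-! ### Consequences of (T1) -/

/-- Near `w`, the vertical lift `V^v` is of the form `J(Y)` with `Y` projecting onto `V`. -/
theorem exists_smoothOn_almostTangentField_eq {O : Set M} (hO : IsOpen O)
    {V : (x : M) → TangentSpace 𝓘(ℝ, E) x} (hV : SmoothOnBase V O) {w : TangentBundle 𝓘(ℝ, E) M}
    (hw : w ∈ slit E M) (hwO : w.1 ∈ O) :
    ∃ U ⊆ slit E M, IsOpen U ∧ w ∈ U ∧ (∀ p ∈ U, p.1 ∈ O) ∧
      (∀ p ∈ U, p.1 ∈ (chartAt E w.1).source) ∧ ∃ Y : Field E M, SmoothOn Y U ∧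
        ∀ p ∈ U, almostTangentField Y p = vliftField V p := by
  refine ⟨slit E M ∩ {p | p.1 ∈ O ∩ (chartAt E w.1).source}, inter_subset_left,
    isOpen_slit.inter (isOpen_preimage_proj (hO.inter (chartAt E w.1).open_source)),
    ⟨hw, hwO, mem_chart_source E w.1⟩, fun p hp => hp.2.1, fun p hp => hp.2.2, coordLift w V, ?_,
    fun p hp => almostTangent_coordLift hp.2.2 V⟩
  exact ContMDiffOn.mono (smoothOn_coordLift w (hO.inter (chartAt E w.1).open_source)
    (ContMDiffOn.mono hV inter_subset_left) inter_subset_right) inter_subset_right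

theorem isVerticalSectionOn_almostTangentField {U : Set (TangentBundle 𝓘(ℝ, E) M)} (hU : IsOpen U)
    {Y : Field E M} (hY : SmoothOn Y U) : IsVerticalSectionOn (almostTangentField Y) U :=
  ⟨smoothOn_almostTangentField hU hY, fun w _ => isVertical_vlift w _⟩

/-- Under (T1), `∇_S V^v` does not depend on the lift of `Γ_S`. -/
theorem VerticalConnection.IsLift.cov_vliftField_spray_eq {D D' : VerticalConnection E M}
    {S : Field E M} (hS : IsSpray S) (hD : D.IsLift S) (hT : D.T1 S) (hD' : D'.IsLift S)
    (hT' : D'.T1 S) {O : Set M} (hO : IsOpen O) {V : (x : M) → TangentSpace 𝓘(ℝ, E) x}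
    (hV : SmoothOnBase V O) {w : TangentBundle 𝓘(ℝ, E) M} (hw : w ∈ slit E M) (hwO : w.1 ∈ O) :
    D.cov (vliftField V) w (S w) = D'.cov (vliftField V) w (S w) := by
  obtain ⟨U, hUs, hU, hwU, hUO, -, Y, hY, hJY⟩ :=
    exists_smoothOn_almostTangentField_eq hO hV hw hwO
  -- This is (T1) solved for $\nabla_SV^{\mathfrak v}$; `cov_congr` is needed since $\mathcal
  -- J(Y)=V^{\mathfrak v}$ and $\mathcal J(S)=C$ are known only on `U`.
  have key : ∀ {N : VerticalConnection E M}, N.T1 S → N.cov (vliftField V) w (S w) =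
      N.cov (canonicalField E M) w (Y w) + almostTangent w (bracket S Y w) := by
    intro N hN
    have h1 := N.cov_congr hUs hU (isVerticalSectionOn_almostTangentField hU hY)
      (isVerticalSectionOn_vliftField hO hV hUO) hJY hwU (S w)
    have h2 := N.cov_congr hUs hU
      (isVerticalSectionOn_almostTangentField hU (ContMDiffOn.mono hS.smooth hUs))
      (isVerticalSectionOn_canonicalField U) (fun p hp => hS.second_order p (hUs hp)) hwU (Y w)
    have h3 := hN U hUs hU Y hY w hwU
    rw [VerticalConnection.torsion, h1, h2, sub_sub, sub_eq_zero] at h3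
    exact h3
  rw [key hT, key hT', hD.cov_canonicalField_eq hD' hw]

theorem VerticalConnection.affine_spray_eq [FiniteDimensional ℝ E] {D D' : VerticalConnection E M}
    {S : Field E M} (hS : IsSpray S) (hD : D.IsLift S) (hT : D.T1 S) (hD' : D'.IsLift S)
    (hT' : D'.T1 S) {O : Set M} (hO : IsOpen O) {V : (x : M) → TangentSpace 𝓘(ℝ, E) x}
    (hV : SmoothOnBase V O) {w : TangentBundle 𝓘(ℝ, E) M} (hw : w ∈ slit E M) (hwO : w.1 ∈ O) :
    D.affine S w w.2 V = D'.affine S w w.2 V := by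
  rw [VerticalConnection.affine, VerticalConnection.affine, hS.horizontalLift_eq hD hw,
    VerticalConnection.affineAlong, VerticalConnection.affineAlong,
    hD.cov_vliftField_spray_eq hS hT hD' hT' hO hV hw hwO]

/-! ### Consequences of (T3) -/

/-- Under (T3), `∇_ξ V^v = 0` for vertical `ξ`. -/
theorem VerticalConnection.T3.cov_vliftField_eq_zero [CompleteSpace E]
    {D : VerticalConnection E M} (hT : D.T3)
    {O : Set M} (hO : IsOpen O) {V : (x : M) → TangentSpace 𝓘(ℝ, E) x}
    (hV : SmoothOnBase V O) {w : TangentBundle 𝓘(ℝ, E) M} (hw : w ∈ slit E M) (hwO : w.1 ∈ O)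
    {ξ : TangentSpace 𝓘(ℝ, E).tangent w} (hξ : IsVertical ξ) :
    D.cov (vliftField V) w ξ = 0 := by
  obtain ⟨U, hUs, hU, hwU, hUO, hUc, Y, hY, hJY⟩ :=
    exists_smoothOn_almostTangentField_eq hO hV hw hwO
  -- With constant coefficients the first component of `X` stays zero, so `X` is vertical on all of
  -- `U` and not just at `w`.
  let X : Field E M := FiberBundle.extend (E × E) ξ
  have hXw : X w = ξ := FiberBundle.extend_apply_self _ _
  have hX : SmoothOn X U := ContMDiffOn.mono (smoothOn_extend ξ) hUc
  have hXv : ∀ p ∈ U, IsVertical (X p) := by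
    intro p hp
    rw [isVertical_iff_totalCoord (hUc p hp), totalCoord_extend (hUc p hp),
      ← isVertical_iff_totalCoord (mem_chart_source E w.1)]
    exact hξ
  have h1 := D.cov_congr hUs hU (isVerticalSectionOn_almostTangentField hU hY)
    (isVerticalSectionOn_vliftField hO hV hUO) hJY hwU (X w)
  have h2 : D.cov (almostTangentField X) w (Y w) = 0 :=
    D.cov_eq_zero hUs hU (isVerticalSectionOn_almostTangentField hU hX)
      (fun p hp => almostTangent_eq_zero (hXv p hp)) hwU (Y w)
  have h3 : almostTangent w (bracket X Y w) = 0 :=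
    almostTangent_eq_zero (isVertical_bracket hU hwU hX hY hXv
      fun p hp => dproj_eq_of_almostTangent_eq (hJY p hp))
  have h4 := hT U hUs hU X Y hX hY w hwU
  rw [VerticalConnection.torsion, h1, h2, h3, sub_zero, sub_zero, hXw] at h4
  exact h4

theorem VerticalConnection.T3.cov_vliftField_eq [CompleteSpace E]
    {D : VerticalConnection E M} (hT : D.T3)
    {O : Set M} (hO : IsOpen O) {V : (x : M) → TangentSpace 𝓘(ℝ, E) x}
    (hV : SmoothOnBase V O) {w : TangentBundle 𝓘(ℝ, E) M} (hw : w ∈ slit E M) (hwO : w.1 ∈ O)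
    {ξ η : TangentSpace 𝓘(ℝ, E).tangent w} (h : dproj w ξ = dproj w η) :
    D.cov (vliftField V) w ξ = D.cov (vliftField V) w η := by
  rw [← sub_eq_zero, ← map_sub]
  exact hT.cov_vliftField_eq_zero hO hV hw hwO (by rw [IsVertical, map_sub, h, sub_self])

theorem VerticalConnection.T3.affine_eq [CompleteSpace E] {D : VerticalConnection E M}
    {S : Field E M} (hD : D.IsLift S) (hT : D.T3)
    {O : Set M} (hO : IsOpen O) {V : (x : M) → TangentSpace 𝓘(ℝ, E) x}
    (hV : SmoothOnBase V O) {w : TangentBundle 𝓘(ℝ, E) M} (hw : w ∈ slit E M) (hwO : w.1 ∈ O)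
    {ξ : TangentSpace 𝓘(ℝ, E).tangent w} {u : TangentSpace 𝓘(ℝ, E) w.1} (h : dproj w ξ = u) :
    D.affine S w u V = vliftInv w (D.cov (vliftField V) w ξ) := by
  rw [VerticalConnection.affine, VerticalConnection.affineAlong, hT.cov_vliftField_eq hO hV hw hwO
    ((hD.horizontalLift_spec hw u).2.trans h.symm)]

/-! ### Curves and the main theorem -/

/-- Chain rule for $\pi\circ\overline\lambda=\lambda$. A nontrivial interval has unique derivatives
at all its points, end points included. -/
theorem dproj_liftVelocity {c : ℝ → M} {I : Set ℝ} (hI : I.OrdConnected) (hI' : I.Nontrivial)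
    {l : (t : ℝ) → TangentSpace 𝓘(ℝ, E) (c t)} (hl : SmoothAlong c I l) {t : ℝ} (ht : t ∈ I) :
    dproj (⟨c t, l t⟩ : TangentBundle 𝓘(ℝ, E) M) (liftVelocity c I l t) = velocity c I t := by
  have hu : UniqueMDiffWithinAt 𝓘(ℝ, ℝ) I t := by
    refine UniqueDiffWithinAt.uniqueMDiffWithinAt ?_
    exact uniqueDiffWithinAt_convex hI.convex
      (hI.convex.nontrivial_iff_nonempty_interior.1 hI') (subset_closure ht)
  have h1 : MDifferentiableWithinAt 𝓘(ℝ, ℝ) 𝓘(ℝ, E).tangent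
      (fun s => (⟨c s, l s⟩ : TangentBundle 𝓘(ℝ, E) M)) I t :=
    (hl t ht).mdifferentiableWithinAt (by simp)
  have h2 := (mdifferentiableAt_proj (⟨c t, l t⟩ : TangentBundle 𝓘(ℝ, E) M)).hasMFDerivAt
  have h3 := h2.comp_hasMFDerivWithinAt t h1.hasMFDerivWithinAt
  exact (DFunLike.congr_fun (h3.mfderivWithin hu) (1 : ℝ)).symm

/-- `vliftInv` is a bare `Function.invFun`; its additivity is available only on the image of $i_w$,
which is the vertical subspace. -/
theorem vliftInv_add {w : TangentBundle 𝓘(ℝ, E) M} {ξ : TangentSpace 𝓘(ℝ, E).tangent w}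
    (hξ : IsVertical ξ) (u : TangentSpace 𝓘(ℝ, E) w.1) :
    vliftInv w (vlift w u + ξ) = u + vliftInv w ξ := by
  conv_lhs => rw [← vlift_vliftInv w ξ hξ, ← vlift_add, vliftInv_vlift]

theorem VerticalConnection.isVertical_cov_vliftField (D : VerticalConnection E M)
    {O : Set M} (hO : IsOpen O) {V : (x : M) → TangentSpace 𝓘(ℝ, E) x}
    (hV : SmoothOnBase V O) {w : TangentBundle 𝓘(ℝ, E) M} (hw : w ∈ slit E M) (hwO : w.1 ∈ O)
    (ξ : TangentSpace 𝓘(ℝ, E).tangent w) : IsVertical (D.cov (vliftField V) w ξ) :=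
  D.vertical (slit E M ∩ {p | p.1 ∈ O}) inter_subset_left
    (isOpen_slit.inter (isOpen_preimage_proj hO)) _
    (isVerticalSectionOn_vliftField hO hV fun _ hp => hp.2) w ⟨hw, hwO⟩ ξ

end SprayGeometry

theorem mainTheorem4
    {E : Type*} [NormedAddCommGroup E] [NormedSpace ℝ E] [FiniteDimensional ℝ E]
    {M : Type*} [TopologicalSpace M] [T2Space M] [ChartedSpace E M] [IsManifold 𝓘(ℝ, E) ∞ M]
    (S : SprayGeometry.Field E M) (hS : SprayGeometry.IsSpray S) :
    -- (1) under (T1), independence of the choice of the lift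
    (∀ D D' : SprayGeometry.VerticalConnection E M,
      D.IsLift S → D.T1 S → D'.IsLift S → D'.T1 S →
      (∀ O : Set M, IsOpen O → ∀ W V : (x : M) → TangentSpace 𝓘(ℝ, E) x,
        SprayGeometry.SmoothOnBase W O → (∀ x ∈ O, W x ≠ 0) → SprayGeometry.SmoothOnBase V O →
        ∀ x ∈ O, D.affineField S W W V x = D'.affineField S W W V x) ∧
      (∀ (I : Set ℝ) (c : ℝ → M), I.OrdConnected → I.Nontrivial →
        ContMDiffOn 𝓘(ℝ, ℝ) 𝓘(ℝ, E) ∞ c I →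
        (∀ t ∈ I, SprayGeometry.velocity (E := E) c I t ≠ 0) →
        ∀ V : (t : ℝ) → TangentSpace 𝓘(ℝ, E) (c t), SprayGeometry.SmoothAlong c I V →
        ∀ t ∈ I, D.covDeriv S c I t (SprayGeometry.velocity c I t) V =
          D'.covDeriv S c I t (SprayGeometry.velocity c I t) V)) ∧
    -- (2) under (T3), horizontal lifts may be replaced by arbitrary lifts
    (∀ D : SprayGeometry.VerticalConnection E M, D.IsLift S → D.T3 →
      (∀ O : Set M, IsOpen O → ∀ V : (x : M) → TangentSpace 𝓘(ℝ, E) x,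
        SprayGeometry.SmoothOnBase V O →
        ∀ w ∈ SprayGeometry.slit E M, w.1 ∈ O → ∀ u : TangentSpace 𝓘(ℝ, E) w.1,
        ∀ ξ : TangentSpace 𝓘(ℝ, E).tangent w, SprayGeometry.dproj w ξ = u →
        D.affine S w u V = SprayGeometry.vliftInv w (D.cov (SprayGeometry.vliftField V) w ξ)) ∧
      (∀ (I : Set ℝ) (c : ℝ → M), I.OrdConnected → I.Nontrivial →
        ContMDiffOn 𝓘(ℝ, ℝ) 𝓘(ℝ, E) ∞ c I →
        ∀ V : (t : ℝ) → TangentSpace 𝓘(ℝ, E) (c t), SprayGeometry.SmoothAlong c I V →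
        ∀ l : (t : ℝ) → TangentSpace 𝓘(ℝ, E) (c t), SprayGeometry.SmoothAlong c I l →
        (∀ t ∈ I, l t ≠ 0) →
        ∀ t₀ ∈ I, D.covDeriv S c I t₀ (l t₀) V =
          SprayGeometry.vliftInv (⟨c t₀, l t₀⟩ : TangentBundle 𝓘(ℝ, E) M)
            (D.covDerivLift c I l V t₀))) := by
  have : CompleteSpace E := FiniteDimensional.complete ℝ E
  refine ⟨fun D D' hD hT hD' hT' => ⟨fun O hO W V _ hW0 hV x hx => ?_,
    fun I c _ _ _ hc0 V _ t ht => ?_⟩, fun D hD hT => ⟨fun O hO V hV w hw hwO u ξ hξ => ?_,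
    fun I c hI hI' _ V _ l hl hl0 t ht => ?_⟩⟩
  · exact SprayGeometry.VerticalConnection.affine_spray_eq hS hD hT hD' hT' hO hV
      (w := ⟨x, W x⟩) (hW0 x hx) hx
  -- The term `coordDeriv` does not involve the connection, so only $D^{\dot\lambda}_{\dot\lambda}$
  -- of the frozen field has to be compared; that field is smooth on the chart domain.
  · exact congrArg (SprayGeometry.coordDeriv c I V t + ·)
      (SprayGeometry.VerticalConnection.affine_spray_eq hS hD hT hD' hT'
        (chartAt E (c t)).open_source (SprayGeometry.smoothOnBase_extend (V t))
        (w := ⟨c t, SprayGeometry.velocity c I t⟩) (hc0 t ht) (mem_chart_source E (c t)))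
  · exact hT.affine_eq hD hO hV hw hwO hξ
  · have hf : SprayGeometry.SmoothOnBase (SprayGeometry.frozen c V t) (chartAt E (c t)).source :=
      SprayGeometry.smoothOnBase_extend (V t)
    rw [SprayGeometry.VerticalConnection.covDeriv, SprayGeometry.VerticalConnection.covDerivLift,
      SprayGeometry.vliftInv_add (D.isVertical_cov_vliftField (chartAt E (c t)).open_source hf
        (hl0 t ht) (mem_chart_source E (c t)) _),
      hT.affine_eq hD (chartAt E (c t)).open_source hf (hl0 t ht) (mem_chart_source E (c t))
        (SprayGeometry.dproj_liftVelocity hI hI' hl ht)]
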